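/- Let $t\in\mathbb{C}$ and let $(a_n(t))_{n\ge 1}$ be the sequence of complex numbers defined by $a_1(t)=a_2(t)=1$ and, for all $n\ge 1$, $$n(n+1)^2\,a_{n+2}(t)=n(2n+1)\,a_{n+1}(t)+\bigl(n^3+(-1)^{n+1}t\bigr)\,a_n(t).$$ Then the infinite product $\prod_{n=1}^{\infty}\left(1+\frac{t}{8n^3}\right)$ converges unconditionally, the sequence $(a_n(t))_{n\ge1}$ converges, and $$\lim_{n\to\infty}a_n(t)=\prod_{n=1}^{\infty}\left(1+\frac{t}{8n^3}\right).$$ -/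

import Mathlib

open Filter Topology

/-! With d_n = a_{n+1} - a_n, the recurrence reads (n+1)² d_{n+1} + n² d_n = (-1)^{n+1} t a_n / n.
It is solved by wedges. The series c, s, p with coefficients `coefC`, `coefS`, `coefP` satisfy a
linear system in D = X d/dX. For its solutions with (c₀, s₀) = (1, 0) and (0, 2), the wedges V = c∧p
and Q = c∧s satisfy equations whose coefficients are this recurrence, split by parity of n
(`exists_intermediate`, `terms_eq`). The even terms are half the partial sums of V(1), and the odd
terms differ from them by coefficients of Q, which tend to 0. By Cauchy products V(1) is the limit
of the determinant of the partial sums of c and p, which telescopes to twice the product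
(`partialSums_det`, `tendsto_sum_wedgeP`). -/

/-- Partial sums of the coefficient sequences `coefC` and `coefP`, started at index one. -/
noncomputable def partialSums (t c₀ s₀ : ℂ) : ℕ → ℂ × ℂ
  | 0 => (c₀, s₀ + t * c₀)
  | k + 1 =>
    ((partialSums t c₀ s₀ k).1 + (partialSums t c₀ s₀ k).2 / (4 * ((k : ℂ) + 1) ^ 2),
     (partialSums t c₀ s₀ k).2 +
      (-t * (partialSums t c₀ s₀ k).1 / (2 * ((k : ℂ) + 1)) +
        t * ((partialSums t c₀ s₀ k).2 / (4 * ((k : ℂ) + 1) ^ 2))) / (2 * ((k : ℂ) + 1) + 1))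

noncomputable def coefC (t c₀ s₀ : ℂ) : ℕ → ℂ
  | 0 => c₀
  | k + 1 => (partialSums t c₀ s₀ k).2 / (4 * ((k : ℂ) + 1) ^ 2)

noncomputable def coefS (t c₀ s₀ : ℂ) : ℕ → ℂ
  | 0 => s₀
  | k + 1 => -t * (partialSums t c₀ s₀ k).1 / (2 * ((k : ℂ) + 1))

noncomputable def coefP (t c₀ s₀ : ℂ) (m : ℕ) : ℂ :=
  (coefS t c₀ s₀ m + t * coefC t c₀ s₀ m) / (2 * (m : ℂ) + 1)

theorem sum_coefC (t c₀ s₀ : ℂ) (k : ℕ) :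
    ∑ i ∈ Finset.range (k + 1), coefC t c₀ s₀ i = (partialSums t c₀ s₀ k).1 := by
  induction k with
  | zero => simp [coefC, partialSums]
  | succ k ih => rw [Finset.sum_range_succ, ih]; simp [coefC, partialSums]

theorem sum_coefP (t c₀ s₀ : ℂ) (k : ℕ) :
    ∑ i ∈ Finset.range (k + 1), coefP t c₀ s₀ i = (partialSums t c₀ s₀ k).2 := by
  induction k with
  | zero => simp [coefC, coefS, coefP, partialSums]
  | succ k ih => rw [Finset.sum_range_succ, ih]; simp [coefC, coefS, coefP, partialSums]

/-- With x = k + 1, the linear step from k to k + 1 has determinant 1 + t/(4x²(2x+1)) · (1 + 1/(2x))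
= 1 + t/(8x³). -/
theorem partialSums_det (t : ℂ) (k : ℕ) :
    (partialSums t 1 0 k).1 * (partialSums t 0 2 k).2 -
      (partialSums t 1 0 k).2 * (partialSums t 0 2 k).1 =
    2 * ∏ i ∈ Finset.range k, (1 + t / (8 * ((i : ℂ) + 1) ^ 3)) := by
  induction k with
  | zero => simp [partialSums]
  | succ k ih =>
    rw [Finset.prod_range_succ, ← mul_assoc, ← ih]
    simp only [partialSums]
    have h1 : (k : ℂ) + 1 ≠ 0 := by exact_mod_cast k.succ_ne_zero
    have h2 : 2 * ((k : ℂ) + 1) + 1 ≠ 0 := by exact_mod_cast (2 * (k + 1)).succ_ne_zero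
    generalize (k : ℂ) + 1 = x at h1 h2 ⊢
    generalize hy : 2 * x + 1 = y at h2 ⊢
    field_simp
    rw [← hy]
    ring

/-! ### Differential system and its wedges -/

section PowerSeries

open PowerSeries

/-- The Euler derivation `X d/dX` on power series. -/
noncomputable def eulerD (f : ℂ⟦X⟧) : ℂ⟦X⟧ := X * d⁄dX ℂ f

theorem coeff_eulerD (f : ℂ⟦X⟧) (n : ℕ) : coeff n (eulerD f) = n * coeff n f := by
  cases n with
  | zero => simp [eulerD]
  | succ n => simp [eulerD, coeff_succ_X_mul, coeff_derivative, mul_comm]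

theorem eulerD_mul (f g : ℂ⟦X⟧) : eulerD (f * g) = eulerD f * g + f * eulerD g := by
  simp only [eulerD, Derivation.leibniz, smul_eq_mul]; ring

theorem eulerD_add (f g : ℂ⟦X⟧) : eulerD (f + g) = eulerD f + eulerD g := by
  simp only [eulerD, map_add]; ring

theorem eulerD_sub (f g : ℂ⟦X⟧) : eulerD (f - g) = eulerD f - eulerD g := by
  simp only [eulerD, map_sub]; ring

theorem coeff_geom_mul (f : ℂ⟦X⟧) (n : ℕ) :
    coeff n (mk 1 * f) = ∑ i ∈ Finset.range (n + 1), coeff i f := by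
  rw [mul_comm, coeff_mul, Finset.Nat.sum_antidiagonal_eq_sum_range_succ_mk]
  simp

/-- `mk 1` is 1/(1-X), so multiplying by `X * mk 1` sums the coefficients of lower index; this turns
the recursion into differential equations. -/
theorem eulerD_coefS (t c₀ s₀ : ℂ) :
    2 * eulerD (mk (coefS t c₀ s₀)) = -(C t * (X * (mk 1 * mk (coefC t c₀ s₀)))) := by
  ext n
  rw [show (2 : ℂ⟦X⟧) = C 2 from (map_ofNat C 2).symm, map_neg, coeff_C_mul, coeff_C_mul, coeff_eulerD, coeff_mk]
  cases n with
  | zero => simp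
  | succ k =>
    have h1 : (k : ℂ) + 1 ≠ 0 := by exact_mod_cast k.succ_ne_zero
    rw [coeff_succ_X_mul, coeff_geom_mul]
    simp only [coeff_mk, sum_coefC, coefS]
    push_cast
    field_simp

theorem eulerD_eulerD_coefC (t c₀ s₀ : ℂ) :
    4 * eulerD (eulerD (mk (coefC t c₀ s₀))) = X * (mk 1 * mk (coefP t c₀ s₀)) := by
  ext n
  rw [show (4 : ℂ⟦X⟧) = C 4 from (map_ofNat C 4).symm, coeff_C_mul, coeff_eulerD, coeff_eulerD, coeff_mk]
  cases n with
  | zero => simp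
  | succ k =>
    have h1 : (k : ℂ) + 1 ≠ 0 := by exact_mod_cast k.succ_ne_zero
    rw [coeff_succ_X_mul, coeff_geom_mul]
    simp only [coeff_mk, sum_coefP, coefC]
    push_cast
    field_simp

theorem eulerD_coefP (t c₀ s₀ : ℂ) :
    2 * eulerD (mk (coefP t c₀ s₀)) + mk (coefP t c₀ s₀) =
      mk (coefS t c₀ s₀) + C t * mk (coefC t c₀ s₀) := by
  ext n
  rw [show (2 : ℂ⟦X⟧) = C 2 from (map_ofNat C 2).symm, map_add, map_add, coeff_C_mul, coeff_C_mul, coeff_eulerD]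
  have h2 : 2 * (n : ℂ) + 1 ≠ 0 := by exact_mod_cast (2 * n).succ_ne_zero
  simp only [coeff_mk, coefP]
  field_simp

theorem eulerD_two_mul (f : ℂ⟦X⟧) : eulerD (2 * f) = 2 * eulerD f := by
  rw [two_mul, eulerD_add, two_mul]

theorem eulerD_C_mul (t : ℂ) (f : ℂ⟦X⟧) : eulerD (C t * f) = C t * eulerD f := by
  ext n
  simp only [coeff_eulerD, coeff_C_mul]
  ring

section Wedge

variable {t : ℂ} {G c s p c' s' p' : ℂ⟦X⟧}

/-- The terms c·Ds' - c'·Ds cancel because Ds is the same multiple of c in both solutions. -/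
theorem eulerD_wedge
    (hs : 2 * eulerD s = -(C t * (X * (G * c)))) (hs' : 2 * eulerD s' = -(C t * (X * (G * c')))) :
    eulerD (c * s' - s * c') = eulerD c * s' - s * eulerD c' := by
  have h2 : (2 : ℂ⟦X⟧) ≠ 0 := by
    rw [← map_ofNat (C (R := ℂ)) 2, Ne, map_eq_zero_iff C C_injective]
    exact two_ne_zero
  refine mul_left_cancel₀ h2 ?_
  rw [eulerD_sub, eulerD_mul, eulerD_mul]
  linear_combination c * hs' - c' * hs

theorem eulerD_eulerD_wedge
    (hs : 2 * eulerD s = -(C t * (X * (G * c)))) (hs' : 2 * eulerD s' = -(C t * (X * (G * c'))))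
    (hc : 4 * eulerD (eulerD c) = X * (G * p)) (hc' : 4 * eulerD (eulerD c') = X * (G * p')) :
    4 * eulerD (eulerD (c * s' - s * c')) =
      X * G * (2 * (C t * (c * eulerD c' - eulerD c * c')) + (p * s' - s * p')) := by
  rw [eulerD_wedge hs hs', eulerD_sub, eulerD_mul, eulerD_mul]
  linear_combination s' * hc - s * hc' + 2 * eulerD c * hs' - 2 * eulerD c' * hs

/-- The left side is (2D+1)²(V - Q). Since (2D+1)V = 2(Dc∧p) + Q, a second application of 2D+1
eliminates Dc∧p. -/
theorem odd_part_eulerD_wedge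
    (hs : 2 * eulerD s = -(C t * (X * (G * c)))) (hs' : 2 * eulerD s' = -(C t * (X * (G * c'))))
    (hc : 4 * eulerD (eulerD c) = X * (G * p)) (hc' : 4 * eulerD (eulerD c') = X * (G * p'))
    (hp : 2 * eulerD p + p = s + C t * c) (hp' : 2 * eulerD p' + p' = s' + C t * c')
    {V Q : ℂ⟦X⟧} (hV : V = c * p' - p * c') (hQ : Q = c * s' - s * c') :
    4 * eulerD (eulerD (V - Q)) + 4 * eulerD (V - Q) + (V - Q) =
      -4 * eulerD (eulerD Q) - 2 * (C t * (c * eulerD c' - eulerD c * c')) := by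
  have hV1 : 2 * eulerD V + V = 2 * (eulerD c * p' - p * eulerD c') + Q := by
    rw [hV, hQ, eulerD_sub, eulerD_mul, eulerD_mul]
    linear_combination c * hp' - c' * hp
  have hV2 := congrArg eulerD hV1
  have hQ1 : eulerD Q = eulerD c * s' - s * eulerD c' := hQ ▸ eulerD_wedge hs hs'
  simp only [eulerD_add, eulerD_two_mul, eulerD_sub, eulerD_mul p,
    eulerD_mul (eulerD c)] at hV2 ⊢
  linear_combination 2 * hV2 + hV1 - 2 * hQ1 + p' * hc - p * hc' + 2 * eulerD c * hp'
    - 2 * eulerD c' * hp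

theorem eulerD_wedge_even (hc : 4 * eulerD (eulerD c) = X * (G * p))
    (hc' : 4 * eulerD (eulerD c') = X * (G * p')) :
    2 * eulerD (2 * (C t * (c * eulerD c' - eulerD c * c'))) =
      C t * (X * (G * (c * p' - p * c'))) := by
  rw [eulerD_two_mul, eulerD_C_mul, eulerD_sub, eulerD_mul, eulerD_mul]
  linear_combination C t * (c * hc' - c' * hc)

theorem eulerD_wedge_odd
    (hs : 2 * eulerD s = -(C t * (X * (G * c)))) (hs' : 2 * eulerD s' = -(C t * (X * (G * c'))))
    (hp : 2 * eulerD p + p = s + C t * c) (hp' : 2 * eulerD p' + p' = s' + C t * c') :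
    2 * eulerD (p * s' - s * p') + (p * s' - s * p') =
      C t * (X * (G * (c * p' - p * c')) + (c * s' - s * c')) := by
  rw [eulerD_sub, eulerD_mul, eulerD_mul]
  linear_combination s' * hp - s * hp' + p * hs' - p' * hs

end Wedge

end PowerSeries

/-! ### Growth estimates -/

/-- Discrete Grönwall inequality. -/
theorem bounded_of_le_one_add_mul {u b : ℕ → ℝ} (hu : ∀ n, 0 ≤ u n) (hb : ∀ n, 0 ≤ b n)
    (hs : Summable b) (h : ∀ n, u (n + 1) ≤ (1 + b n) * u n) :
    ∃ M, 0 ≤ M ∧ ∀ n, u n ≤ M := by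
  have key : ∀ n, u n ≤ Real.exp (∑ i ∈ Finset.range n, b i) * u 0 := by
    intro n
    induction n with
    | zero => simp
    | succ n ih =>
      rw [Finset.sum_range_succ, add_comm (∑ i ∈ _, _), Real.exp_add, mul_assoc]
      refine (h n).trans (mul_le_mul ?_ ih (hu n) (Real.exp_nonneg _))
      linarith [Real.add_one_le_exp (b n)]
  refine ⟨Real.exp (∑' i, b i) * u 0, mul_nonneg (Real.exp_nonneg _) (hu 0), fun n => ?_⟩
  refine (key n).trans (mul_le_mul_of_nonneg_right ?_ (hu 0))
  exact Real.exp_le_exp.2 (hs.sum_le_tsum _ fun i _ => hb i)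

theorem summable_one_div_succ_sq : Summable fun n : ℕ => 1 / ((n : ℝ) + 1) ^ 2 := by
  have h := (summable_nat_add_iff 1).2 (Real.summable_one_div_nat_pow.2 one_lt_two)
  simpa using h

/-- Needed since `coefS` is only bounded by O(1/n): the Cauchy product of a summable and a null
sequence is null. -/
theorem tendsto_sum_antidiagonal_zero {f g : ℕ → ℂ} (hf : Summable fun n => ‖f n‖)
    (hg : Tendsto g atTop (𝓝 0)) :
    Tendsto (fun n => ∑ q ∈ Finset.HasAntidiagonal.antidiagonal n, f q.1 * g q.2) atTop (𝓝 0) := by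
  obtain ⟨M, hM⟩ := hg.norm.bddAbove_range
  have hM' : ∀ n, ‖g n‖ ≤ M := fun n => hM ⟨n, rfl⟩
  have hM0 : 0 ≤ M := (norm_nonneg _).trans (hM' 0)
  have key := tendsto_tsum_of_dominated_convergence
    (f := fun n k => if k ∈ Finset.range (n + 1) then f k * g (n - k) else 0)
    (g := fun _ => (0 : ℂ)) (𝓕 := atTop) (bound := fun k => ‖f k‖ * M) (hf.mul_right M)
    (fun k => by
      have h1 : Tendsto (fun n => f k * g (n - k)) atTop (𝓝 (f k * 0)) :=
        (hg.comp (tendsto_sub_atTop_nat k)).const_mul _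
      rw [mul_zero] at h1
      refine h1.congr' ?_
      filter_upwards [eventually_ge_atTop k] with n hn
      rw [if_pos (Finset.mem_range.2 (by omega))])
    (Eventually.of_forall fun n k => by
      split_ifs
      · rw [norm_mul]; exact mul_le_mul_of_nonneg_left (hM' _) (norm_nonneg _)
      · simpa using mul_nonneg (norm_nonneg _) hM0)
  rw [tsum_zero] at key
  refine key.congr fun n => ?_
  rw [tsum_eq_sum (s := Finset.range (n + 1)) (fun b hb => if_neg hb),
    Finset.Nat.sum_antidiagonal_eq_sum_range_succ_mk]
  exact Finset.sum_congr rfl fun k hk => if_pos hk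

theorem norm_coefC_succ_le (t c₀ s₀ : ℂ) (k : ℕ) :
    ‖coefC t c₀ s₀ (k + 1)‖ ≤
      (‖(partialSums t c₀ s₀ k).1‖ + ‖(partialSums t c₀ s₀ k).2‖) * (1 / ((k : ℝ) + 1) ^ 2) := by
  have hk : ‖(k : ℂ) + 1‖ = (k : ℝ) + 1 := by exact_mod_cast Complex.norm_natCast (k + 1)
  have h1 := norm_nonneg (partialSums t c₀ s₀ k).1
  have h2 := norm_nonneg (partialSums t c₀ s₀ k).2
  simp only [coefC, norm_div, norm_mul, norm_pow, hk, Complex.norm_ofNat]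
  rw [mul_one_div]
  gcongr
  · linarith
  · nlinarith [sq_nonneg ((k : ℝ) + 1)]

theorem norm_coefS_succ_le (t c₀ s₀ : ℂ) (k : ℕ) :
    ‖coefS t c₀ s₀ (k + 1)‖ ≤
      ‖t‖ * (‖(partialSums t c₀ s₀ k).1‖ + ‖(partialSums t c₀ s₀ k).2‖) * (1 / ((k : ℝ) + 1)) := by
  have hk : ‖(k : ℂ) + 1‖ = (k : ℝ) + 1 := by exact_mod_cast Complex.norm_natCast (k + 1)
  have h1 := norm_nonneg (partialSums t c₀ s₀ k).1
  have h2 := norm_nonneg (partialSums t c₀ s₀ k).2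
  simp only [coefS, norm_div, norm_mul, norm_neg, hk, Complex.norm_ofNat]
  rw [mul_one_div]
  gcongr
  · linarith
  · linarith [(k.cast_nonneg : (0 : ℝ) ≤ k)]

theorem norm_coefP_succ_le (t c₀ s₀ : ℂ) (k : ℕ) :
    ‖coefP t c₀ s₀ (k + 1)‖ ≤
      ‖t‖ * (‖(partialSums t c₀ s₀ k).1‖ + ‖(partialSums t c₀ s₀ k).2‖) *
        (1 / ((k : ℝ) + 1) ^ 2) := by
  have hk : ‖2 * ((k + 1 : ℕ) : ℂ) + 1‖ = 2 * ((k : ℝ) + 1) + 1 := by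
    exact_mod_cast Complex.norm_natCast (2 * (k + 1) + 1)
  have hk0 : (0 : ℝ) ≤ k := k.cast_nonneg
  have h1 := norm_coefC_succ_le t c₀ s₀ k
  have h2 := norm_coefS_succ_le t c₀ s₀ k
  have h3 : ‖t * coefC t c₀ s₀ (k + 1)‖ ≤
      ‖t‖ * (‖(partialSums t c₀ s₀ k).1‖ + ‖(partialSums t c₀ s₀ k).2‖) * (1 / ((k : ℝ) + 1)) := by
    rw [norm_mul, mul_assoc]
    refine mul_le_mul_of_nonneg_left (h1.trans ?_) (norm_nonneg _)
    gcongr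
    nlinarith
  rw [coefP, norm_div, hk, div_le_iff₀ (by positivity)]
  refine (norm_add_le _ _).trans ((add_le_add h2 h3).trans ?_)
  set N := ‖t‖ * (‖(partialSums t c₀ s₀ k).1‖ + ‖(partialSums t c₀ s₀ k).2‖) with hN
  have hN0 : 0 ≤ N := by positivity
  rw [mul_assoc N, ← mul_add]
  refine mul_le_mul_of_nonneg_left ?_ hN0
  -- What remains is 2(k+1) ≤ 2k+3: the divisor 2m+1 in `coefP` supplies the second power of
  -- 1/(k+1).
  rw [div_mul_eq_mul_div, ← add_div, div_le_div_iff₀ (by positivity) (by positivity)]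
  nlinarith [mul_nonneg hk0 hk0]

theorem exists_bound_partialSums (t c₀ s₀ : ℂ) :
    ∃ M, 0 ≤ M ∧ ∀ k, ‖(partialSums t c₀ s₀ k).1‖ + ‖(partialSums t c₀ s₀ k).2‖ ≤ M := by
  refine bounded_of_le_one_add_mul (b := fun n : ℕ => (1 + ‖t‖) * (1 / ((n : ℝ) + 1) ^ 2))
    (fun n => by positivity) (fun n => by positivity) (summable_one_div_succ_sq.mul_left _)
    fun n => ?_
  have h1 := norm_coefC_succ_le t c₀ s₀ n
  have h2 := norm_coefP_succ_le t c₀ s₀ n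
  rw [← sum_coefC t c₀ s₀ (n + 1), ← sum_coefP t c₀ s₀ (n + 1), Finset.sum_range_succ _ (n + 1),
    Finset.sum_range_succ _ (n + 1), sum_coefC, sum_coefP]
  refine (add_le_add (norm_add_le _ _) (norm_add_le _ _)).trans ?_
  linarith

theorem summable_coefC (t c₀ s₀ : ℂ) : Summable fun n => ‖coefC t c₀ s₀ n‖ := by
  obtain ⟨M, -, hM⟩ := exists_bound_partialSums t c₀ s₀
  rw [← summable_nat_add_iff 1]
  refine Summable.of_nonneg_of_le (fun _ => norm_nonneg _) (fun k => ?_)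
    (summable_one_div_succ_sq.mul_left M)
  exact (norm_coefC_succ_le t c₀ s₀ k).trans (by gcongr; exact hM k)

theorem summable_coefP (t c₀ s₀ : ℂ) : Summable fun n => ‖coefP t c₀ s₀ n‖ := by
  obtain ⟨M, -, hM⟩ := exists_bound_partialSums t c₀ s₀
  rw [← summable_nat_add_iff 1]
  refine Summable.of_nonneg_of_le (fun _ => norm_nonneg _) (fun k => ?_)
    (summable_one_div_succ_sq.mul_left (‖t‖ * M))
  exact (norm_coefP_succ_le t c₀ s₀ k).trans (by gcongr; exact hM k)

theorem tendsto_coefS (t c₀ s₀ : ℂ) : Tendsto (coefS t c₀ s₀) atTop (𝓝 0) := by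
  obtain ⟨M, -, hM⟩ := exists_bound_partialSums t c₀ s₀
  rw [← tendsto_add_atTop_iff_nat 1]
  refine squeeze_zero_norm (a := fun k : ℕ => ‖t‖ * M * (1 / ((k : ℝ) + 1))) (fun k => ?_) ?_
  · exact (norm_coefS_succ_le t c₀ s₀ k).trans (by gcongr; exact hM k)
  · simpa using tendsto_one_div_add_atTop_nhds_zero_nat.const_mul (‖t‖ * M)

/-! ### Wedge coefficients and their limits -/

/-- Coefficients of the wedge of the `C` and `P` series of the two basic solutions. -/
noncomputable def wedgeP (t : ℂ) (n : ℕ) : ℂ :=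
  (∑ q ∈ Finset.HasAntidiagonal.antidiagonal n, coefC t 1 0 q.1 * coefP t 0 2 q.2) -
    ∑ q ∈ Finset.HasAntidiagonal.antidiagonal n, coefP t 1 0 q.1 * coefC t 0 2 q.2

/-- Coefficients of the wedge of the `C` and `S` series of the two basic solutions. -/
noncomputable def wedgeS (t : ℂ) (n : ℕ) : ℂ :=
  (∑ q ∈ Finset.HasAntidiagonal.antidiagonal n, coefC t 1 0 q.1 * coefS t 0 2 q.2) -
    ∑ q ∈ Finset.HasAntidiagonal.antidiagonal n, coefS t 1 0 q.1 * coefC t 0 2 q.2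

theorem mk_wedgeP (t : ℂ) : PowerSeries.mk (wedgeP t) =
    PowerSeries.mk (coefC t 1 0) * PowerSeries.mk (coefP t 0 2) -
      PowerSeries.mk (coefP t 1 0) * PowerSeries.mk (coefC t 0 2) := by
  ext n
  simp [wedgeP, PowerSeries.coeff_mul]

theorem mk_wedgeS (t : ℂ) : PowerSeries.mk (wedgeS t) =
    PowerSeries.mk (coefC t 1 0) * PowerSeries.mk (coefS t 0 2) -
      PowerSeries.mk (coefS t 1 0) * PowerSeries.mk (coefC t 0 2) := by
  ext n
  simp [wedgeS, PowerSeries.coeff_mul]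

theorem tendsto_wedgeS (t : ℂ) : Tendsto (wedgeS t) atTop (𝓝 0) := by
  have h1 := tendsto_sum_antidiagonal_zero (summable_coefC t 1 0) (tendsto_coefS t 0 2)
  have h2 := tendsto_sum_antidiagonal_zero (summable_coefC t 0 2) (tendsto_coefS t 1 0)
  have h3 := h1.sub h2
  rw [sub_zero] at h3
  refine h3.congr fun n => ?_
  rw [wedgeS, ← Finset.Nat.sum_antidiagonal_swap (f := fun q => coefS t 1 0 q.1 * coefC t 0 2 q.2)]
  simp [mul_comm]

theorem multipliable_factors (t : ℂ) :
    Multipliable (fun n : ℕ => 1 + t / (8 * ((n : ℂ) + 1) ^ 3)) := by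
  refine multipliable_one_add_of_summable ?_
  refine Summable.of_nonneg_of_le (fun _ => norm_nonneg _) (fun n => ?_)
    (summable_one_div_succ_sq.mul_left ‖t‖)
  have hk : ‖(n : ℂ) + 1‖ = (n : ℝ) + 1 := by exact_mod_cast Complex.norm_natCast (n + 1)
  have hn : (0 : ℝ) ≤ n := n.cast_nonneg
  rw [norm_div, norm_mul, norm_pow, hk, Complex.norm_ofNat, mul_one_div]
  gcongr
  nlinarith [pow_nonneg hn 2, pow_nonneg hn 3]

theorem tendsto_sum_wedgeP (t : ℂ) :
    Tendsto (fun m => ∑ i ∈ Finset.range (m + 1), wedgeP t i) atTop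
      (𝓝 (2 * ∏' n : ℕ, (1 + t / (8 * ((n : ℂ) + 1) ^ 3)))) := by
  have hc := fun c₀ s₀ => summable_coefC t c₀ s₀
  have hp := fun c₀ s₀ => summable_coefP t c₀ s₀
  have lc := fun c₀ s₀ => (((hc c₀ s₀).of_norm.hasSum.tendsto_sum_nat).comp
    (tendsto_add_atTop_nat 1)).congr fun k => sum_coefC t c₀ s₀ k
  have lp := fun c₀ s₀ => (((hp c₀ s₀).of_norm.hasSum.tendsto_sum_nat).comp
    (tendsto_add_atTop_nat 1)).congr fun k => sum_coefP t c₀ s₀ k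
  have hdet := (((lc 1 0).mul (lp 0 2)).sub ((lp 1 0).mul (lc 0 2))).congr (partialSums_det t)
  have hlim := tendsto_nhds_unique hdet
    ((multipliable_factors t).hasProd.tendsto_prod_nat.const_mul 2)
  rw [← hlim, tsum_mul_tsum_eq_tsum_sum_antidiagonal_of_summable_norm (hc 1 0) (hp 0 2),
    tsum_mul_tsum_eq_tsum_sum_antidiagonal_of_summable_norm (hp 1 0) (hc 0 2)]
  have s1 := (summable_norm_sum_mul_antidiagonal_of_summable_norm (hc 1 0) (hp 0 2)).of_norm
  have s2 := (summable_norm_sum_mul_antidiagonal_of_summable_norm (hp 1 0) (hc 0 2)).of_norm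
  exact ((s1.hasSum.sub s2.hasSum).tendsto_sum_nat).comp (tendsto_add_atTop_nat 1)

/-! ### Recurrence for the two parities -/

/-- The odd-indexed terms, `a (2 * m + 1)`. -/
noncomputable def oddTerm (t : ℂ) (m : ℕ) : ℂ :=
  (∑ i ∈ Finset.range m, wedgeP t i + wedgeS t m) / 2

/-- The even-indexed terms, `a (2 * m + 2)`. -/
noncomputable def evenTerm (t : ℂ) (m : ℕ) : ℂ :=
  (∑ i ∈ Finset.range (m + 1), wedgeP t i) / 2

theorem coeff_X_geom_wedgeP (t : ℂ) (m : ℕ) :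
    PowerSeries.coeff m (PowerSeries.X * (PowerSeries.mk 1 * PowerSeries.mk (wedgeP t))) =
      ∑ i ∈ Finset.range m, wedgeP t i := by
  cases m with
  | zero => simp
  | succ m => rw [PowerSeries.coeff_succ_X_mul, coeff_geom_mul]; simp

open PowerSeries in
-- Here v and w are the coefficients of 2t(c∧Dc) and p∧s; they play the roles of 2t a_n/n for n = 2m
-- and n = 2m+1.
theorem exists_intermediate (t : ℂ) : ∃ v w : ℕ → ℂ,
    (∀ m : ℕ, 2 * m * v m = t * ∑ i ∈ Finset.range m, wedgeP t i) ∧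
    (∀ m : ℕ, (2 * m + 1) * w m = t * (∑ i ∈ Finset.range m, wedgeP t i + wedgeS t m)) ∧
    (∀ m : ℕ, (2 * m + 1) ^ 2 * (wedgeP t m - wedgeS t m) + 4 * m ^ 2 * wedgeS t m = - v m) ∧
    (∀ m : ℕ, 4 * (m + 1 : ℂ) ^ 2 * wedgeS t (m + 1) +
      (2 * m + 1) ^ 2 * (wedgeP t m - wedgeS t m) = w m) := by
  have hs := eulerD_coefS t 1 0
  have hs' := eulerD_coefS t 0 2
  have hc := eulerD_eulerD_coefC t 1 0
  have hc' := eulerD_eulerD_coefC t 0 2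
  have hp := eulerD_coefP t 1 0
  have hp' := eulerD_coefP t 0 2
  have h1 := eulerD_wedge_even (t := t) hc hc'
  have h2 := eulerD_wedge_odd hs hs' hp hp'
  have h3 := odd_part_eulerD_wedge hs hs' hc hc' hp hp' (mk_wedgeP t) (mk_wedgeS t)
  have h4 := eulerD_eulerD_wedge hs hs' hc hc'
  rw [← mk_wedgeP] at h1 h2
  rw [← mk_wedgeS] at h2 h4
  set v := 2 * (C t * (mk (coefC t 1 0) * eulerD (mk (coefC t 0 2)) -
    eulerD (mk (coefC t 1 0)) * mk (coefC t 0 2))) with hv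
  set w := mk (coefP t 1 0) * mk (coefS t 0 2) - mk (coefS t 1 0) * mk (coefP t 0 2) with hw
  have hG : (mk 1 : ℂ⟦X⟧) = 1 + X * mk 1 := by
    ext n
    cases n <;> simp [coeff_succ_X_mul, coeff_one]
  have h5 : 4 * eulerD (eulerD (mk (wedgeS t))) + X * (4 * eulerD (eulerD (mk (wedgeP t) -
      mk (wedgeS t))) + 4 * eulerD (mk (wedgeP t) - mk (wedgeS t)) +
        (mk (wedgeP t) - mk (wedgeS t))) = X * w := by
    -- Multiplying `h4` by 1 - X clears the factor 1/(1-X), and `h3` then cancels v.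
    linear_combination X * h3 + (1 - X) * h4 + X * (v + w) * hG
  have c2 : (2 : ℂ⟦X⟧) = C 2 := (map_ofNat C 2).symm
  have c4 : (4 : ℂ⟦X⟧) = C 4 := (map_ofNat C 4).symm
  have h3' : 4 * eulerD (eulerD (mk (wedgeP t) - mk (wedgeS t))) +
      4 * eulerD (mk (wedgeP t) - mk (wedgeS t)) + (mk (wedgeP t) - mk (wedgeS t)) +
        4 * eulerD (eulerD (mk (wedgeS t))) = -v := by
    linear_combination h3
  refine ⟨fun m => coeff m v, fun m => coeff m w, fun m => ?_, fun m => ?_, fun m => ?_,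
    fun m => ?_⟩
  · have := congrArg (coeff m) h1
    rw [c2, coeff_C_mul, coeff_eulerD, coeff_C_mul, coeff_X_geom_wedgeP] at this
    rw [← this]; ring
  · have := congrArg (coeff m) h2
    rw [c2, map_add, coeff_C_mul, coeff_eulerD, coeff_C_mul, map_add, coeff_X_geom_wedgeP,
      coeff_mk] at this
    rw [← this]; ring
  · have := congrArg (coeff m) h3'
    simp only [c4, map_add, map_sub, map_neg, coeff_C_mul, coeff_eulerD, coeff_mk] at this
    rw [← this]; ring
  · have := congrArg (coeff (m + 1)) h5
    simp only [c4, map_add, map_sub, coeff_succ_X_mul, coeff_C_mul, coeff_eulerD, coeff_mk] at this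
    refine Eq.trans ?_ this; push_cast; ring

theorem evenTerm_sub_oddTerm (t : ℂ) (m : ℕ) :
    evenTerm t m - oddTerm t m = (wedgeP t m - wedgeS t m) / 2 := by
  rw [evenTerm, oddTerm, Finset.sum_range_succ]; ring

theorem oddTerm_succ_sub_evenTerm (t : ℂ) (m : ℕ) :
    oddTerm t (m + 1) - evenTerm t m = wedgeS t (m + 1) / 2 := by
  rw [evenTerm, oddTerm]; ring

theorem oddTerm_succ (t : ℂ) (m : ℕ) :
    (2 * m + 1 : ℂ) * (2 * m + 2) ^ 2 * oddTerm t (m + 1) =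
      (2 * m + 1) * (4 * m + 3) * evenTerm t m + ((2 * m + 1) ^ 3 + t) * oddTerm t m := by
  obtain ⟨v, w, -, h2, -, h4⟩ := exists_intermediate t
  have e1 := evenTerm_sub_oddTerm t m
  have e2 := oddTerm_succ_sub_evenTerm t m
  have e3 : oddTerm t m = (∑ i ∈ Finset.range m, wedgeP t i + wedgeS t m) / 2 := rfl
  linear_combination (2 * m + 1 : ℂ) * (2 * m + 2) ^ 2 * e2 + (2 * m + 1 : ℂ) ^ 3 * e1 - t * e3
    + (h2 m + (2 * m + 1 : ℂ) * h4 m) / 2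

theorem evenTerm_succ (t : ℂ) (m : ℕ) :
    (2 * m + 2 : ℂ) * (2 * m + 3) ^ 2 * evenTerm t (m + 1) =
      (2 * m + 2) * (4 * m + 5) * oddTerm t (m + 1) + ((2 * m + 2) ^ 3 - t) * evenTerm t m := by
  obtain ⟨v, w, h1, -, h3, -⟩ := exists_intermediate t
  have e1 := evenTerm_sub_oddTerm t (m + 1)
  have e2 := oddTerm_succ_sub_evenTerm t m
  have e3 : evenTerm t m = (∑ i ∈ Finset.range (m + 1), wedgeP t i) / 2 := rfl
  have h1' := h1 (m + 1)
  have h3' := h3 (m + 1)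
  push_cast at h1' h3' e1
  linear_combination (2 * m + 2 : ℂ) * (2 * m + 3) ^ 2 * e1 + (2 * m + 2 : ℂ) ^ 3 * e2 + t * e3
    + (-h1' + (2 * m + 2 : ℂ) * h3') / 2

theorem terms_eq {t : ℂ} {a : ℕ → ℂ} (h1 : a 1 = 1) (h2 : a 2 = 1)
    (hrec : ∀ n : ℕ, 1 ≤ n →
      (n : ℂ) * ((n : ℂ) + 1) ^ 2 * a (n + 2) =
        (n : ℂ) * (2 * (n : ℂ) + 1) * a (n + 1) +
          ((n : ℂ) ^ 3 + (-1 : ℂ) ^ (n + 1) * t) * a n) (m : ℕ) :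
    a (2 * m + 1) = oddTerm t m ∧ a (2 * m + 2) = evenTerm t m := by
  induction m with
  | zero =>
    -- Both wedges have constant term 2, from s₀ = 2; halving gives the initial value 1.
    simp [oddTerm, evenTerm, wedgeP, wedgeS, coefP, coefC, coefS, h1, h2]
  | succ m ih =>
    obtain ⟨iho, ihe⟩ := ih
    have n1 : (2 * m + 1 : ℂ) ≠ 0 := by exact_mod_cast (2 * m).succ_ne_zero
    have n2 : (2 * m + 2 : ℂ) ≠ 0 := by exact_mod_cast (2 * m + 1).succ_ne_zero
    have n3 : (2 * m + 3 : ℂ) ≠ 0 := by exact_mod_cast (2 * m + 2).succ_ne_zero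
    have ho : a (2 * (m + 1) + 1) = oddTerm t (m + 1) := by
      have h := hrec (2 * m + 1) (by omega)
      rw [Even.neg_one_pow (by use m + 1; ring), show 2 * m + 1 + 1 = 2 * m + 2 from rfl,
        iho, ihe] at h
      refine mul_left_cancel₀ (mul_ne_zero n1 (pow_ne_zero 2 n2)) ?_
      rw [oddTerm_succ, show 2 * (m + 1) + 1 = 2 * m + 1 + 2 by ring]
      push_cast at h
      linear_combination h
    refine ⟨ho, ?_⟩
    have h := hrec (2 * m + 2) (by omega)
    rw [Odd.neg_one_pow (by use m + 1; ring), show 2 * m + 2 + 1 = 2 * (m + 1) + 1 by ring,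
      ho, ihe] at h
    refine mul_left_cancel₀ (mul_ne_zero n2 (pow_ne_zero 2 n3)) ?_
    rw [evenTerm_succ, show 2 * (m + 1) + 2 = 2 * m + 2 + 2 by ring]
    push_cast at h
    linear_combination h

/-! ### Conclusion -/

theorem tendsto_of_even_of_odd {a : ℕ → ℂ} {L : ℂ}
    (ho : Tendsto (fun m => a (2 * m + 1)) atTop (𝓝 L))
    (he : Tendsto (fun m => a (2 * m + 2)) atTop (𝓝 L)) : Tendsto a atTop (𝓝 L) := by
  rw [Metric.tendsto_atTop] at *
  intro ε hε
  obtain ⟨N, hN⟩ := ho ε hε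
  obtain ⟨N', hN'⟩ := he ε hε
  refine ⟨2 * N + 2 * N' + 2, fun n hn => ?_⟩
  rcases Nat.even_or_odd' n with ⟨k, rfl | rfl⟩
  · have := hN' (k - 1) (by omega)
    rwa [show 2 * (k - 1) + 2 = 2 * k by omega] at this
  · exact hN k (by omega)

theorem corollary4p7 (t : ℂ) (a : ℕ → ℂ) (h1 : a 1 = 1) (h2 : a 2 = 1)
    (hrec : ∀ n : ℕ, 1 ≤ n →
      (n : ℂ) * ((n : ℂ) + 1) ^ 2 * a (n + 2) =
        (n : ℂ) * (2 * (n : ℂ) + 1) * a (n + 1) +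
          ((n : ℂ) ^ 3 + (-1 : ℂ) ^ (n + 1) * t) * a n) :
    Multipliable (fun n : ℕ => 1 + t / (8 * ((n : ℂ) + 1) ^ 3)) ∧
      Tendsto a atTop (𝓝 (∏' n : ℕ, (1 + t / (8 * ((n : ℂ) + 1) ^ 3)))) := by
  refine ⟨multipliable_factors t, ?_⟩
  have hP := tendsto_sum_wedgeP t
  refine tendsto_of_even_of_odd ?_ ?_
  · simp only [(terms_eq h1 h2 hrec _).1, oddTerm]
    have h := (((tendsto_add_atTop_iff_nat (f := fun m => ∑ i ∈ Finset.range m, wedgeP t i) 1).1 hP).add (tendsto_wedgeS t)).div_const 2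
    simpa using h
  · simp only [(terms_eq h1 h2 hrec _).2, evenTerm]
    simpa using hP.div_const 2
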